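/- An oriented graph $D$ is a directed graph on a finite vertex set $V$ without loops and without pairs of opposite arcs. For (not necessarily disjoint) $A,B\subseteq V$ let $e(A,B)$ denote the number of arcs $\vec{xy}$ of $D$ with $x\in A$ and $y\in B$. For $\eta\in(0,1)$ put $$bias_\eta(D)=\max\{e(A,B) : A,B\subseteq V,\ e(B,A)\le \eta\, e(A,B)\}.$$ A vertex is isolated if no arc starts or ends at it. Theorem. For each $\eta\in(0,1)$ there is a constant $K_\eta$ such that, for every integer $n\ge 2$, there is an oriented graph $D$ on $n$ vertices, none of which is isolated, with $$bias_\eta(D)\le K_\eta\,\frac{n}{\log_2 n}.$$ -/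

import Mathlib

namespace OrientedGraphBias

variable {V : Type*}

/-- A digraph is an oriented graph if it has no loops and no two arcs in opposite directions
between the same vertices (asymmetry of the arc relation includes the absence of loops). -/
def IsOriented (D : Digraph V) : Prop :=
  ∀ x y : V, D.Adj x y → ¬ D.Adj y x

/-- Every vertex is the end point (tail or head) of at least one arc. -/
def NoIsolatedVertex (D : Digraph V) : Prop :=
  ∀ x : V, ∃ y : V, D.Adj x y ∨ D.Adj y x

open Classical in
/-- `e(A, B)`: the number of arcs `(x, y)` with `x ∈ A` and `y ∈ B`. The sets `A` and `B` need not
be disjoint. -/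
noncomputable def arcCount (D : Digraph V) (A B : Finset V) : ℕ :=
  ((A ×ˢ B).filter fun p => D.Adj p.1 p.2).card

/-- The subgraph `E(A, B)` is `η`-biased: `e(B, A) ≤ η e(A, B)`. -/
def IsBiased (D : Digraph V) (η : ℝ) (A B : Finset V) : Prop :=
  (arcCount D B A : ℝ) ≤ η * (arcCount D A B : ℝ)

open Classical in
/-- `bias_η(D)`: the maximum of `e(A, B)` over all pairs `A, B` of sets of vertices such that
`E(A, B)` is `η`-biased. -/
noncomputable def bias [Fintype V] (D : Digraph V) (η : ℝ) : ℕ :=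
  ((Finset.univ : Finset (Finset V × Finset V)).filter fun p => IsBiased D η p.1 p.2).sup
    fun p => arcCount D p.1 p.2

/-- The maximum in the definition of `bias` is a maximum over a nonempty set and is attained. -/
theorem isGreatest_bias [Fintype V] (D : Digraph V) (η : ℝ) :
    IsGreatest {m : ℕ | ∃ A B : Finset V, IsBiased D η A B ∧ arcCount D A B = m} (bias D η) := by
  classical
  constructor
  · have hne : ((Finset.univ : Finset (Finset V × Finset V)).filter
        fun p => IsBiased D η p.1 p.2).Nonempty :=
      ⟨(∅, ∅), Finset.mem_filter.2 ⟨Finset.mem_univ _, by simp [IsBiased, arcCount]⟩⟩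
    obtain ⟨p, hp, h⟩ := Finset.exists_mem_eq_sup _ hne fun p => arcCount D p.1 p.2
    refine ⟨p.1, p.2, (Finset.mem_filter.1 hp).2, ?_⟩
    rw [bias, ← h]
  · rintro m ⟨A, B, hAB, rfl⟩
    exact Finset.le_sup (f := fun p : Finset V × Finset V => arcCount D p.1 p.2) (b := (A, B))
      (Finset.mem_filter.2 ⟨Finset.mem_univ _, hAB⟩)

end OrientedGraphBias

namespace BiasConstruction

/-! The graph is bipartite, between hubs (a field `F` with `q = 2 ^ k` elements, `k` of order `log
n`) and many leaves. For `1 < lam < 1 / η`, an η-biased pair has `(1 - lam * η) * e(A, B) ≤ e(A, B)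
- lam * e(B, A)`, so it suffices to bound the right side, the excess, by `O(n / k)` for all `A`,
`B`. Each leaf then matters only through the hubs it sees in `A` or in `B`, and may be replaced by
its positive part (`arcCount_sub_le`).

A leaf sees an affine preimage of a set of size `2 ^ i`, `i < k`, with signs `χ (c * x + d * x ^
3)`. If it meets a hub set in `m` points, the fourth moment of the signs bounds the mean positive
part by a constant times `min m (1 / m)` (`sum_excess_signs_le`). Pairwise independence of affine
maps concentrates `m` near its mean `μ = 2 ^ i * |S| / q` (`sum_min_card_affineTrace_le`). As `μ`
doubles with each scale, the sum of `min μ (6 / μ)` over all scales is bounded (`sum_scales_le`):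
only boundedly many of the `k` scales matter for any one hub set, which gains the factor `1 / k`. -/

theorem exists_sign_character (F : Type*) [Field F] [Algebra (ZMod 2) F] :
    ∃ χ : F → ℝ, (∀ u, χ u = 1 ∨ χ u = -1) ∧ (∀ u v, χ (u + v) = χ u * χ v) ∧
      ∃ u, χ u = -1 := by
  have h1 : ∃ f : Module.Dual (ZMod 2) F, f 1 ≠ 0 := by
    by_contra! h
    exact one_ne_zero ((Module.forall_dual_apply_eq_zero_iff (ZMod 2) (1 : F)).1 h)
  obtain ⟨f, hf⟩ := h1
  have h2 : ∀ z : ZMod 2, z = 0 ∨ z = 1 := by decide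
  have h3 : (1 + 1 : ZMod 2) = 0 := by decide
  refine ⟨fun u => if f u = 0 then 1 else -1, fun u => ?_, fun u v => ?_, 1, by simp [hf]⟩
  · by_cases h : f u = 0 <;> simp [h]
  · rcases h2 (f u) with hu | hu <;> rcases h2 (f v) with hv | hv <;> simp [hu, hv, h3]

/-! ### Sign characters in characteristic two and their fourth moment. -/

section Character

variable {F : Type*} [Field F] [Fintype F] {χ : F → ℝ}

/-- Orthogonality: for `s ≠ 0`, translating `c` by `u / s` with `χ u = -1` negates the sum. -/
theorem sum_character_mul (hχ : ∀ u, χ u = 1 ∨ χ u = -1)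
    (hadd : ∀ u v, χ (u + v) = χ u * χ v) (hne : ∃ u, χ u = -1) (s : F) [Decidable (s = 0)] :
    ∑ c, χ (c * s) = if s = 0 then (Fintype.card F : ℝ) else 0 := by
  have h0 : χ 0 = 1 := by
    have h := hadd 0 0
    rw [add_zero] at h
    rcases hχ 0 with h1 | h1
    · exact h1
    · rw [h1] at h; norm_num at h
  split_ifs with hs
  · simp [hs, h0]
  · obtain ⟨u, hu⟩ := hne
    have h := Fintype.sum_equiv (Equiv.addRight (u / s)) (fun c => χ ((c + u / s) * s))
      (fun c => χ (c * s)) (fun c => rfl)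
    have h' : ∀ c, χ ((c + u / s) * s) = -χ (c * s) := fun c => by
      rw [add_mul, div_mul_cancel₀ _ hs, hadd, hu]; ring
    simp only [h', Finset.sum_neg_distrib] at h
    linarith

/-- In characteristic two, vanishing of the first and third power sums of four elements forces
them to coincide in pairs. -/
theorem paired_of_power_sums {F : Type*} [Field F] [CharP F 2] {x y z w : F} (h1 : x + y + z + w = 0)
    (h3 : x ^ 3 + y ^ 3 + z ^ 3 + w ^ 3 = 0) :
    (x = y ∧ z = w) ∨ (x = z ∧ y = w) ∨ (x = w ∧ y = z) := by
  have h2 : (2 : F) = 0 := CharTwo.two_eq_zero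
  have hw : w = x + y + z := by linear_combination h1 - (x + y + z) * h2
  -- This is `(x + y + z) ^ 3 - x ^ 3 - y ^ 3 - z ^ 3 = 3 * (x + y) * (y + z) * (z + x)` read modulo
  -- 2.
  have hp : (x + y) * ((y + z) * (z + x)) = 0 := by
    subst hw
    linear_combination h3 - (x^3 + y^3 + z^3 + (x + y) * ((y + z) * (z + x))) * h2
  rcases mul_eq_zero.1 hp with h | h
  · left; exact ⟨by linear_combination h - y * h2, by rw [hw, h, zero_add]⟩
  rcases mul_eq_zero.1 h with h | h
  · right; right
    exact ⟨by rw [hw, add_assoc, h, add_zero], by linear_combination h - z * h2⟩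
  · right; left
    exact ⟨by linear_combination h - z * h2, by rw [hw]; linear_combination -h⟩

open Classical in
theorem card_power_sums_le {F : Type*} [Field F] [CharP F 2] (R : Finset F) :
    ((R ×ˢ R ×ˢ R ×ˢ R).filter fun p => p.1 + p.2.1 + p.2.2.1 + p.2.2.2 = 0 ∧
      p.1 ^ 3 + p.2.1 ^ 3 + p.2.2.1 ^ 3 + p.2.2.2 ^ 3 = 0).card ≤ 3 * R.card ^ 2 := by
  have hsub : ((R ×ˢ R ×ˢ R ×ˢ R).filter fun p => p.1 + p.2.1 + p.2.2.1 + p.2.2.2 = 0 ∧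
      p.1 ^ 3 + p.2.1 ^ 3 + p.2.2.1 ^ 3 + p.2.2.2 ^ 3 = 0) ⊆
      (R ×ˢ R).image (fun p => (p.1, p.1, p.2, p.2)) ∪
      ((R ×ˢ R).image (fun p => (p.1, p.2, p.1, p.2)) ∪
      (R ×ˢ R).image (fun p => (p.1, p.2, p.2, p.1))) := by
    rintro ⟨x, y, z, w⟩ h
    simp only [Finset.mem_filter, Finset.mem_product] at h
    obtain ⟨⟨hx, hy, hz, hw⟩, h1, h3⟩ := h
    simp only [Finset.mem_union, Finset.mem_image, Finset.mem_product, Prod.exists,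
      Prod.mk.injEq]
    rcases paired_of_power_sums h1 h3 with ⟨rfl, rfl⟩ | ⟨rfl, rfl⟩ | ⟨rfl, rfl⟩
    · exact Or.inl ⟨x, z, ⟨hx, hz⟩, rfl, rfl, rfl, rfl⟩
    · exact Or.inr (Or.inl ⟨x, y, ⟨hx, hy⟩, rfl, rfl, rfl, rfl⟩)
    · exact Or.inr (Or.inr ⟨x, y, ⟨hx, hy⟩, rfl, rfl, rfl, rfl⟩)
  refine (Finset.card_le_card hsub).trans ?_
  have hc : ∀ f : F × F → F × F × F × F, ((R ×ˢ R).image f).card ≤ R.card ^ 2 := fun f =>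
    Finset.card_image_le.trans (by rw [Finset.card_product, sq])
  refine (Finset.card_union_le _ _).trans ?_
  have := Finset.card_union_le ((R ×ˢ R).image (fun p => (p.1, p.2, p.1, p.2)))
    ((R ×ˢ R).image (fun p => (p.1, p.2, p.2, p.1)))
  have h1 := hc (fun p => (p.1, p.1, p.2, p.2))
  have h2 := hc (fun p => (p.1, p.2, p.1, p.2))
  have h3 := hc (fun p => (p.1, p.2, p.2, p.1))
  omega

/-- Expanding the fourth power and summing over `c` and `d` leaves only quadruples with vanishing
first and third power sums. These coincide in pairs, and there are three pairings. -/
theorem fourth_moment_le [CharP F 2] (hχ : ∀ u, χ u = 1 ∨ χ u = -1)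
    (hadd : ∀ u v, χ (u + v) = χ u * χ v) (hne : ∃ u, χ u = -1) (R : Finset F) :
    ∑ c, ∑ d, (∑ x ∈ R, χ (c * x + d * x ^ 3)) ^ 4 ≤
      3 * (R.card : ℝ) ^ 2 * (Fintype.card F : ℝ) ^ 2 := by
  classical
  have hexp : ∀ c d : F, (∑ x ∈ R, χ (c * x + d * x ^ 3)) ^ 4 =
      ∑ p ∈ R ×ˢ R ×ˢ R ×ˢ R, χ (c * (p.1 + p.2.1 + p.2.2.1 + p.2.2.2)) *
        χ (d * (p.1 ^ 3 + p.2.1 ^ 3 + p.2.2.1 ^ 3 + p.2.2.2 ^ 3)) := by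
    intro c d
    have hprod : ∀ x y z w : F, χ (c * (x + y + z + w)) * χ (d * (x ^ 3 + y ^ 3 + z ^ 3 + w ^ 3)) =
        χ (c * x + d * x ^ 3) * (χ (c * y + d * y ^ 3) *
          (χ (c * z + d * z ^ 3) * χ (c * w + d * w ^ 3))) := by
      intro x y z w
      simp only [← hadd]
      congr 1; ring
    simp only [hprod, Finset.sum_product, ← Finset.mul_sum, ← Finset.sum_mul]
    ring
  simp only [hexp]
  have hswap : ∑ c, ∑ d, ∑ p ∈ R ×ˢ R ×ˢ R ×ˢ R,
      χ (c * (p.1 + p.2.1 + p.2.2.1 + p.2.2.2)) *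
        χ (d * (p.1 ^ 3 + p.2.1 ^ 3 + p.2.2.1 ^ 3 + p.2.2.2 ^ 3)) =
      ∑ p ∈ R ×ˢ R ×ˢ R ×ˢ R, (∑ c, χ (c * (p.1 + p.2.1 + p.2.2.1 + p.2.2.2))) *
        ∑ d, χ (d * (p.1 ^ 3 + p.2.1 ^ 3 + p.2.2.1 ^ 3 + p.2.2.2 ^ 3)) := by
    simp only [Finset.sum_mul_sum]
    rw [Finset.sum_comm (s := R ×ˢ R ×ˢ R ×ˢ R)]
    exact Finset.sum_congr rfl fun c _ => Finset.sum_comm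
  rw [hswap]
  simp only [sum_character_mul hχ hadd hne]
  have hterm : ∀ p : F × F × F × F,
      ((if p.1 + p.2.1 + p.2.2.1 + p.2.2.2 = 0 then (Fintype.card F : ℝ) else 0) *
        if p.1 ^ 3 + p.2.1 ^ 3 + p.2.2.1 ^ 3 + p.2.2.2 ^ 3 = 0 then (Fintype.card F : ℝ) else 0) =
      (if p.1 + p.2.1 + p.2.2.1 + p.2.2.2 = 0 ∧
        p.1 ^ 3 + p.2.1 ^ 3 + p.2.2.1 ^ 3 + p.2.2.2 ^ 3 = 0 then (Fintype.card F : ℝ) ^ 2 else 0) := by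
    intro p
    rw [ite_and, sq]
    split_ifs <;> simp
  simp only [hterm]
  rw [← Finset.sum_filter, Finset.sum_const, nsmul_eq_mul]
  refine mul_le_mul_of_nonneg_right ?_ (by positivity)
  exact_mod_cast card_power_sums_le R

end Character

/-! ### Mean positive excess of a leaf with random signs. -/

/-- The weight of an arc under `e(A, B) - lam * e(B, A)`, in terms of its sign `t`. -/
noncomputable def excess (lam t : ℝ) : ℝ := ((1 + lam) * t - (lam - 1) * |t|) / 2

/-- A positive left side forces `(1 + lam) * Z > (lam - 1) * k`, so multiplying by the cube of this
ratio only increases the bound. -/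
theorem pos_part_le {lam : ℝ} (hlam : 1 < lam) {Z k : ℝ} (hk : 0 < k) :
    max 0 (((1 + lam) * Z - (lam - 1) * k) / 2) ≤
      (1 + lam) ^ 4 / (lam - 1) ^ 3 * (Z ^ 4 / k ^ 3) := by
  have hc : 0 < lam - 1 := by linarith
  refine max_le (by positivity) ?_
  by_cases h : (1 + lam) * Z ≤ (lam - 1) * k
  · exact le_trans (by linarith) (show (0 : ℝ) ≤ _ by positivity)
  · push Not at h
    have hZ : 0 < (1 + lam) * Z := (by positivity : 0 < (lam - 1) * k).trans h
    have h1 : ((lam - 1) * k) ^ 3 ≤ ((1 + lam) * Z) ^ 3 := by gcongr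
    have h2 : (1 + lam) ^ 4 / (lam - 1) ^ 3 * (Z ^ 4 / k ^ 3) =
        ((1 + lam) * Z) * (((1 + lam) * Z) ^ 3 / ((lam - 1) * k) ^ 3) := by
      field_simp
    rw [h2]
    have h3 : 1 ≤ ((1 + lam) * Z) ^ 3 / ((lam - 1) * k) ^ 3 := by
      rw [one_le_div (by positivity)]; exact h1
    have h4 : 0 ≤ (lam - 1) * k := by positivity
    nlinarith

/-- The constant of the bound for a single neighbourhood. -/
noncomputable def excessConst (lam : ℝ) : ℝ := 3 * ((1 + lam) ^ 4 / (lam - 1) ^ 3) + 1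

/-- The bound by `R.card` is trivial, each weight being at most 1. The bound by its inverse is a
fourth-moment Markov estimate: `3 * m ^ 2` divided by `m ^ 3`. -/
theorem sum_excess_signs_le {F : Type*} [Field F] [Fintype F] [CharP F 2] {χ : F → ℝ}
    (hχ : ∀ u, χ u = 1 ∨ χ u = -1)
    (hadd : ∀ u v, χ (u + v) = χ u * χ v) (hne : ∃ u, χ u = -1) {lam : ℝ} (hlam : 1 < lam)
    {ε : ℝ} (hε : ε = 1 ∨ ε = -1) (R : Finset F) :
    ∑ c, ∑ d, max 0 (∑ x ∈ R, excess lam (ε * χ (c * x + d * x ^ 3))) ≤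
      excessConst lam * (Fintype.card F : ℝ) ^ 2 * min (R.card : ℝ) (R.card : ℝ)⁻¹ := by
  have hc : 0 < lam - 1 := by linarith
  have habs : ∀ u, |ε * χ u| = 1 := fun u => by
    rcases hε with h | h <;> rcases hχ u with h' | h' <;> simp [h, h']
  have hC : 1 ≤ excessConst lam := by
    unfold excessConst
    have : 0 ≤ (1 + lam) ^ 4 / (lam - 1) ^ 3 := by positivity
    linarith
  have hsum : ∀ c d : F, ∑ x ∈ R, excess lam (ε * χ (c * x + d * x ^ 3)) =
      ((1 + lam) * (ε * ∑ x ∈ R, χ (c * x + d * x ^ 3)) - (lam - 1) * R.card) / 2 := by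
    intro c d
    simp only [excess, habs]
    rw [← Finset.sum_div, Finset.sum_sub_distrib, ← Finset.mul_sum, ← Finset.mul_sum]
    simp; ring
  rw [mul_min_of_nonneg _ _ (by positivity)]
  refine le_min ?_ ?_
  · have h1 : ∀ c d : F, max 0 (∑ x ∈ R, excess lam (ε * χ (c * x + d * x ^ 3))) ≤ R.card := by
      intro c d
      refine max_le (by positivity) ?_
      have : ∀ x ∈ R, excess lam (ε * χ (c * x + d * x ^ 3)) ≤ 1 := fun x _ => by
        have := le_abs_self (ε * χ (c * x + d * x ^ 3))
        rw [habs] at this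
        simp only [excess, habs]
        nlinarith
      simpa using Finset.sum_le_card_nsmul R _ 1 this
    calc _ ≤ ∑ c : F, ∑ d : F, (R.card : ℝ) :=
          Finset.sum_le_sum fun c _ => Finset.sum_le_sum fun d _ => h1 c d
      _ = 1 * (Fintype.card F : ℝ) ^ 2 * R.card := by simp; ring
      _ ≤ _ := by gcongr
  · rcases R.eq_empty_or_nonempty with rfl | hR
    · simp
    have hk : (0 : ℝ) < R.card := by exact_mod_cast hR.card_pos
    have hε4 : ∀ t : ℝ, (ε * t) ^ 4 = t ^ 4 := fun t => by 
      rcases hε with h | h <;> rw [h] <;> ring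
    calc _ ≤ ∑ c : F, ∑ d : F, (1 + lam) ^ 4 / (lam - 1) ^ 3 *
            ((∑ x ∈ R, χ (c * x + d * x ^ 3)) ^ 4 / (R.card : ℝ) ^ 3) := by
          refine Finset.sum_le_sum fun c _ => Finset.sum_le_sum fun d _ => ?_
          rw [hsum, ← hε4 (∑ x ∈ R, χ (c * x + d * x ^ 3))]
          exact pos_part_le hlam hk
      _ = (1 + lam) ^ 4 / (lam - 1) ^ 3 *
            ((∑ c : F, ∑ d : F, (∑ x ∈ R, χ (c * x + d * x ^ 3)) ^ 4) / (R.card : ℝ) ^ 3) := by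
          simp only [← Finset.mul_sum, ← Finset.sum_div]
      _ ≤ (1 + lam) ^ 4 / (lam - 1) ^ 3 *
            (3 * (R.card : ℝ) ^ 2 * (Fintype.card F : ℝ) ^ 2 / (R.card : ℝ) ^ 3) := by
          gcongr
          exact fourth_moment_le hχ hadd hne R
      _ = 3 * ((1 + lam) ^ 4 / (lam - 1) ^ 3) * (Fintype.card F : ℝ) ^ 2 * (R.card : ℝ)⁻¹ := by
          field_simp
      _ ≤ _ := by
          unfold excessConst
          gcongr
          linarith

/-! ### Concentration of the traces of random affine preimages. -/

section Affine

variable {F : Type*} [Field F] [Fintype F] [DecidableEq F]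

/-- The points of `S` that the affine map `x ↦ a * x + b` sends into `W`. -/
def affineTrace {F : Type*} [Field F] [DecidableEq F] (S W : Finset F) (a : Fˣ) (b : F) : Finset F :=
  S.filter fun x => (a : F) * x + b ∈ W

theorem card_affineTrace {F : Type*} [Field F] [DecidableEq F] (S W : Finset F) (a : Fˣ) (b : F) :
    ((affineTrace S W a b).card : ℝ) = ∑ x ∈ S, if (a : F) * x + b ∈ W then 1 else 0 := by
  simp [affineTrace]

theorem sum_card_affineTrace (S W : Finset F) :
    ∑ a : Fˣ, ∑ b, ((affineTrace S W a b).card : ℝ) =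
      ((Fintype.card F : ℝ) - 1) * (S.card * W.card) := by
  have h : ∀ (a : Fˣ) (x : F), (∑ b, if (a : F) * x + b ∈ W then (1 : ℝ) else 0) = W.card := by
    intro a x
    rw [Fintype.sum_equiv (Equiv.addLeft ((a : F) * x))
      (fun b => if (a : F) * x + b ∈ W then (1 : ℝ) else 0)
      (fun b => if b ∈ W then (1 : ℝ) else 0) (fun b => rfl)]
    simp
  simp only [card_affineTrace]
  rw [Finset.sum_congr rfl fun a _ => Finset.sum_comm]
  simp only [h]
  simp only [Finset.sum_const, nsmul_eq_mul, Finset.card_univ, Fintype.card_units]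
  rw [Nat.cast_sub Fintype.card_pos]
  simp

/-- An affine map is determined by its values at `x` and `y`, and these are distinct since `a` is a
unit; so the maps counted inject into `W.offDiag`. -/
theorem sum_affine_pair_le (W : Finset F) {x y : F} (hxy : x ≠ y) :
    ∑ a : Fˣ, ∑ b, ((if (a : F) * x + b ∈ W then (1 : ℝ) else 0) *
      if (a : F) * y + b ∈ W then 1 else 0) ≤ W.card * W.card - W.card := by
  have h1 : ∑ a : Fˣ, ∑ b, ((if (a : F) * x + b ∈ W then (1 : ℝ) else 0) *
      if (a : F) * y + b ∈ W then 1 else 0) =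
      ((Finset.univ : Finset (Fˣ × F)).filter fun p =>
        (p.1 : F) * x + p.2 ∈ W ∧ (p.1 : F) * y + p.2 ∈ W).card := by
    rw [Finset.card_filter, ← Fintype.sum_prod_type']
    push_cast
    refine Finset.sum_congr rfl fun p _ => ?_
    rw [ite_and]
    split_ifs <;> simp
  have h2 : ((Finset.univ : Finset (Fˣ × F)).filter fun p =>
        (p.1 : F) * x + p.2 ∈ W ∧ (p.1 : F) * y + p.2 ∈ W).card ≤ W.offDiag.card := by
    refine Finset.card_le_card_of_injOn (fun p => ((p.1 : F) * x + p.2, (p.1 : F) * y + p.2))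
      (fun p hp => ?_) (fun p _ p' _ hpp => ?_)
    · have hp := (Finset.mem_filter.1 hp).2
      refine Finset.mem_coe.2 (Finset.mem_offDiag.2 ⟨hp.1, hp.2, fun h => hxy ?_⟩)
      exact mul_left_cancel₀ p.1.ne_zero (add_right_cancel h)
    · simp only [Prod.mk.injEq] at hpp
      have h : ((p.1 : F) - p'.1) * (x - y) = 0 := by linear_combination hpp.1 - hpp.2
      have h' : (p.1 : F) = p'.1 :=
        sub_eq_zero.1 ((mul_eq_zero.1 h).resolve_right (sub_ne_zero.2 hxy))
      refine Prod.ext (Units.ext h') ?_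
      have := hpp.1
      rw [h'] at this
      exact add_left_cancel this
  rw [h1]
  have h3 : (W.offDiag.card : ℝ) = W.card * W.card - W.card := by
    rw [Finset.offDiag_card, Nat.cast_sub (Nat.le_mul_self _)]; push_cast; rfl
  rw [← h3]
  exact_mod_cast h2

theorem sum_sq_card_affineTrace_le (S W : Finset F) :
    ∑ a : Fˣ, ∑ b, ((affineTrace S W a b).card : ℝ) ^ 2 ≤
      ((Fintype.card F : ℝ) - 1) * (S.card * W.card) +
        (S.card * S.card - S.card) * (W.card * W.card - W.card) := by
  have h1 : ∑ a : Fˣ, ∑ b, ((affineTrace S W a b).card : ℝ) ^ 2 =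
      ∑ p ∈ S ×ˢ S, ∑ a : Fˣ, ∑ b, ((if (a : F) * p.1 + b ∈ W then (1 : ℝ) else 0) *
        if (a : F) * p.2 + b ∈ W then 1 else 0) := by
    symm
    rw [Finset.sum_comm]
    refine Finset.sum_congr rfl fun a _ => ?_
    rw [Finset.sum_comm]
    refine Finset.sum_congr rfl fun b _ => ?_
    rw [card_affineTrace, sq, Finset.sum_mul_sum, Finset.sum_product]
  rw [h1, ← Finset.diag_union_offDiag, Finset.sum_union (Finset.disjoint_diag_offDiag S)]
  refine add_le_add (le_of_eq ?_) ?_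
  · rw [← sum_card_affineTrace S W, Finset.sum_diag, Finset.sum_comm]
    refine Finset.sum_congr rfl fun a _ => ?_
    rw [Finset.sum_comm]
    refine Finset.sum_congr rfl fun b _ => ?_
    rw [card_affineTrace]
    exact Finset.sum_congr rfl fun x _ => by split_ifs <;> simp
  · have h3 : (S.offDiag.card : ℝ) = S.card * S.card - S.card := by
      rw [Finset.offDiag_card, Nat.cast_sub (Nat.le_mul_self _)]; push_cast; rfl
    rw [← h3, ← nsmul_eq_mul]
    exact Finset.sum_le_card_nsmul _ _ _ fun p hp =>
      sum_affine_pair_le W (Finset.mem_offDiag.1 hp).2.2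

/-- A pointwise Chebyshev inequality: either `k ≥ μ / 2`, or the deviation term is at least 1.
Integrality of `k` makes the minimum at most 1. -/
theorem min_inv_le (k : ℕ) {μ : ℝ} (hμ : 0 < μ) :
    min (k : ℝ) (k : ℝ)⁻¹ ≤ 2 / μ + 4 * ((k : ℝ) - μ) ^ 2 / μ ^ 2 := by
  by_cases h : μ / 2 ≤ k
  · have h1 : (k : ℝ)⁻¹ ≤ 2 / μ := by
      rw [inv_le_comm₀ (by linarith) (by positivity), inv_div]; exact h
    have h2 : 0 ≤ 4 * ((k : ℝ) - μ) ^ 2 / μ ^ 2 := by positivity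
    linarith [min_le_right (k : ℝ) (k : ℝ)⁻¹]
  · push Not at h
    have h1 : min (k : ℝ) (k : ℝ)⁻¹ ≤ 1 := by
      rcases Nat.eq_zero_or_pos k with rfl | hk
      · simp
      · exact (min_le_right _ _).trans (inv_le_one_of_one_le₀ (by exact_mod_cast hk))
    have h2 : 1 ≤ 4 * ((k : ℝ) - μ) ^ 2 / μ ^ 2 := by
      rw [one_le_div (by positivity)]; nlinarith
    have : 0 ≤ 2 / μ := by positivity
    linarith

theorem sum_min_card_affineTrace_le (S W : Finset F) (hW : W.Nonempty) :
    ∑ a : Fˣ, ∑ b, min ((affineTrace S W a b).card : ℝ) ((affineTrace S W a b).card : ℝ)⁻¹ ≤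
      ((Fintype.card F : ℝ) - 1) * Fintype.card F *
        min ((S.card : ℝ) * W.card / Fintype.card F)
          (6 / ((S.card : ℝ) * W.card / Fintype.card F)) := by
  have hq : (1 : ℝ) ≤ Fintype.card F := by exact_mod_cast Fintype.card_pos
  have hu : (Fintype.card Fˣ : ℝ) = Fintype.card F - 1 := by
    rw [Fintype.card_units, Nat.cast_sub Fintype.card_pos]; simp
  have hWq : (W.card : ℝ) ≤ Fintype.card F := by exact_mod_cast Finset.card_le_univ W
  have hW1 : (1 : ℝ) ≤ W.card := by exact_mod_cast hW.card_pos
  rcases S.eq_empty_or_nonempty with rfl | hS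
  · simp [affineTrace]
  have hS1 : (1 : ℝ) ≤ S.card := by exact_mod_cast hS.card_pos
  have hm1 := sum_card_affineTrace S W
  have hm2 := sum_sq_card_affineTrace_le S W
  set q : ℝ := (Fintype.card F : ℝ) with hqdef
  set s : ℝ := (S.card : ℝ) with hs
  set w : ℝ := (W.card : ℝ) with hw
  have hμ : 0 < s * w / q := by positivity
  obtain ⟨μ, hμdef⟩ : ∃ μ, μ = s * w / q := ⟨_, rfl⟩
  have hsw : s * w = μ * q := by rw [hμdef]; field_simp
  rw [← hμdef] at hμ ⊢
  rw [mul_min_of_nonneg _ _ (by nlinarith)]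
  refine le_min ?_ ?_
  · calc _ ≤ ∑ a : Fˣ, ∑ b, ((affineTrace S W a b).card : ℝ) :=
          Finset.sum_le_sum fun a _ => Finset.sum_le_sum fun b _ => min_le_left _ _
      _ = _ := by rw [hm1, hsw]; ring
  · have hvar : ∑ a : Fˣ, ∑ b, (((affineTrace S W a b).card : ℝ) - μ) ^ 2 ≤ (q - 1) * q * μ := by
      have h1 : ∑ a : Fˣ, ∑ b, (((affineTrace S W a b).card : ℝ) - μ) ^ 2 =
          ∑ a : Fˣ, ∑ b, ((affineTrace S W a b).card : ℝ) ^ 2 -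
            2 * μ * ∑ a : Fˣ, ∑ b, ((affineTrace S W a b).card : ℝ) + (q - 1) * q * μ ^ 2 := by
        simp only [sub_sq, Finset.sum_add_distrib, Finset.sum_sub_distrib, Finset.mul_sum]
        simp only [Finset.sum_const, Finset.card_univ, nsmul_eq_mul, hu]
        congr 1
        · congr 1
          exact Finset.sum_congr rfl fun a _ => Finset.sum_congr rfl fun b _ => by ring
        · ring
      rw [h1, hm1]
      have hμs : μ ≤ s := by
        rw [hμdef]
        exact (div_le_iff₀ (by linarith)).2 (mul_le_mul_of_nonneg_left hWq (by linarith))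
      have h2 : (s * s - s) * (w * w - w) = s * w * (s * w - s - w + 1) := by ring
      rw [h2, hsw] at hm2
      rw [hsw]
      -- This is exactly the slack between the variance given by the two moments and the
      -- Poisson-like value `μ`.
      have h3 : 0 ≤ μ * q * (s - μ + (w - 1)) := by
        have : 0 ≤ s - μ + (w - 1) := by linarith
        positivity
      nlinarith
    calc _ ≤ ∑ a : Fˣ, ∑ b, (2 / μ + 4 * (((affineTrace S W a b).card : ℝ) - μ) ^ 2 / μ ^ 2) :=
          Finset.sum_le_sum fun a _ => Finset.sum_le_sum fun b _ => min_inv_le _ hμ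
      _ = (q - 1) * q * (2 / μ) +
            4 * (∑ a : Fˣ, ∑ b, (((affineTrace S W a b).card : ℝ) - μ) ^ 2) / μ ^ 2 := by
          simp only [Finset.sum_add_distrib, ← Finset.sum_div, ← Finset.mul_sum]
          simp only [Finset.sum_const, Finset.card_univ, nsmul_eq_mul, hu]
          ring
      _ ≤ (q - 1) * q * (2 / μ) + 4 * ((q - 1) * q * μ) / μ ^ 2 := by gcongr
      _ = _ := by field_simp; ring

end Affine

/-! ### Summation over dyadic scales. -/

/-- Written as a difference of `y / (y + 1)` at `2 * y` and `y`, so that the sum over doubling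
scales telescopes. -/
theorem min_six_div_le {y : ℝ} (hy : 0 ≤ y) :
    min y (6 / y) ≤ 36 * (2 * y / (2 * y + 1) - y / (y + 1)) := by
  have h : 36 * (2 * y / (2 * y + 1) - y / (y + 1)) = 36 * y / ((2 * y + 1) * (y + 1)) := by
    field_simp; ring
  rw [h, le_div_iff₀ (by positivity)]
  rcases le_total y 1 with h1 | h1
  · refine (mul_le_mul_of_nonneg_right (min_le_left _ _) (by positivity)).trans ?_
    have : (2 * y + 1) * (y + 1) ≤ 36 := by nlinarith
    nlinarith
  · refine (mul_le_mul_of_nonneg_right (min_le_right _ _) (by positivity)).trans ?_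
    rw [div_mul_eq_mul_div, div_le_iff₀ (by linarith)]
    nlinarith

theorem sum_scales_le (k : ℕ) {z : ℝ} (hz : 0 ≤ z) :
    ∑ i ∈ Finset.range k, min (2 ^ i * z) (6 / (2 ^ i * z)) ≤ 36 := by
  calc _ ≤ ∑ i ∈ Finset.range k, 36 * ((2 ^ (i + 1) * z) / (2 ^ (i + 1) * z + 1) -
        (2 ^ i * z) / (2 ^ i * z + 1)) := by
        refine Finset.sum_le_sum fun i _ => ?_
        have := min_six_div_le (y := 2 ^ i * z) (by positivity)
        rwa [← mul_assoc, ← pow_succ'] at this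
    _ = 36 * ((2 ^ k * z) / (2 ^ k * z + 1) - (2 ^ 0 * z) / (2 ^ 0 * z + 1)) := by
        rw [← Finset.mul_sum, Finset.sum_range_sub (fun i => (2 ^ i * z) / (2 ^ i * z + 1))]
    _ ≤ 36 := by
        have h1 : (2 ^ k * z) / (2 ^ k * z + 1) ≤ 1 := by
          rw [div_le_one (by positivity)]; linarith
        have h2 : 0 ≤ (2 ^ 0 * z) / (2 ^ 0 * z + 1) := by positivity
        linarith


/-! ### From signs to digraphs: excess, relabelling and bias. -/

open OrientedGraphBias

/-- The bipartite digraph with parts `H` and `J` in which `s j x = 1` encodes an arc from `x : H`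
to `j : J` and `s j x = -1` an arc from `j` to `x`. -/
def signedBipartite {H J : Type*} (s : J → H → ℝ) : Digraph (H ⊕ J) where
  Adj
    | .inl x, .inr j => s j x = 1
    | .inr j, .inl x => s j x = -1
    | _, _ => False

section Adj

variable {H J : Type*} (s : J → H → ℝ) (x y : H) (i j : J)

theorem signedBipartite_adj_inl_inr : (signedBipartite s).Adj (.inl x) (.inr j) ↔ s j x = 1 :=
  Iff.rfl

theorem signedBipartite_adj_inr_inl : (signedBipartite s).Adj (.inr j) (.inl x) ↔ s j x = -1 :=
  Iff.rfl

theorem signedBipartite_adj_inl_inl : (signedBipartite s).Adj (.inl x) (.inl y) ↔ False :=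
  Iff.rfl

theorem signedBipartite_adj_inr_inr : (signedBipartite s).Adj (.inr i) (.inr j) ↔ False :=
  Iff.rfl

end Adj

theorem isOriented_signedBipartite {H J : Type*} (s : J → H → ℝ) :
    IsOriented (signedBipartite s) := by
  rintro (x | j) (y | i) h h' <;> simp only [signedBipartite] at h h'
  all_goals rw [h] at h'; norm_num at h'

open Classical in
theorem arcCount_eq_sum {V : Type*} [Fintype V] (D : Digraph V) (A B : Finset V) :
    (arcCount D A B : ℝ) =
      ∑ u, ∑ v, if u ∈ A ∧ v ∈ B then (if D.Adj u v then (1 : ℝ) else 0) else 0 := by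
  have h : ((A ×ˢ B).filter fun p => D.Adj p.1 p.2) =
      Finset.univ.filter fun p : V × V => (p.1 ∈ A ∧ p.2 ∈ B) ∧ D.Adj p.1 p.2 := by
    ext p; simp
  rw [arcCount, h, Finset.card_filter, ← Fintype.sum_prod_type']
  push_cast
  exact Finset.sum_congr rfl fun p _ => ite_and _ _ _ _

open Classical in
theorem arcCount_sub_eq_sum {V : Type*} [Fintype V] (D : Digraph V) (lam : ℝ) (A B : Finset V) :
    (arcCount D A B : ℝ) - lam * arcCount D B A =
      ∑ u, ∑ v, if u ∈ A ∧ v ∈ B then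
        ((if D.Adj u v then (1 : ℝ) else 0) - lam * if D.Adj v u then 1 else 0) else 0 := by
  have hBA : (arcCount D B A : ℝ) =
      ∑ u, ∑ v, if v ∈ B ∧ u ∈ A then (if D.Adj v u then (1 : ℝ) else 0) else 0 := by
    rw [arcCount_eq_sum, Finset.sum_comm]
  rw [arcCount_eq_sum, hBA]
  simp only [Finset.mul_sum, ← Finset.sum_sub_distrib]
  refine Finset.sum_congr rfl fun u _ => Finset.sum_congr rfl fun v _ => ?_
  by_cases hu : u ∈ A <;> by_cases hv : v ∈ B <;> simp [hu, hv]

theorem excess_eq {lam t : ℝ} (ht : t = 0 ∨ t = 1 ∨ t = -1) [Decidable (t = 1)]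
    [Decidable (t = -1)] :
    excess lam t = (if t = 1 then 1 else 0) - lam * (if t = -1 then 1 else 0) := by
  rcases ht with rfl | rfl | rfl
  · simp [excess]
  · norm_num [excess]
    ring
  · norm_num [excess]
    ring

-- Once the hub parts of `A` and `B` are fixed, leaves contribute independently: one term for
-- membership in `B`, one for membership in `A`. Positive parts bound every choice of leaves at
-- once.
open Classical in
theorem arcCount_sub_le {H J : Type*} [Fintype H] [Fintype J] {s : J → H → ℝ}
    (hs : ∀ j x, s j x = 0 ∨ s j x = 1 ∨ s j x = -1) (lam : ℝ) (A B : Finset (H ⊕ J)) :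
    (arcCount (signedBipartite s) A B : ℝ) - lam * arcCount (signedBipartite s) B A ≤
      ∑ j, max 0 (∑ x with Sum.inl x ∈ A, excess lam (1 * s j x)) +
      ∑ j, max 0 (∑ x with Sum.inl x ∈ B, excess lam (-1 * s j x)) := by
  have hneg : ∀ j x, -1 * s j x = 0 ∨ -1 * s j x = 1 ∨ -1 * s j x = -1 := fun j x => by
    rcases hs j x with h | h | h <;> simp [h]
  have e1 : ∀ j x, excess lam (1 * s j x) =
      (if s j x = 1 then 1 else 0) - lam * (if s j x = -1 then 1 else 0) := fun j x => by
    rw [one_mul, excess_eq (hs j x)]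
  have e2 : ∀ j x, excess lam (-1 * s j x) =
      (if s j x = -1 then 1 else 0) - lam * (if s j x = 1 then 1 else 0) := fun j x => by
    have h3 : -1 * s j x = 1 ↔ s j x = -1 := by
      constructor <;> intro h <;> linarith
    have h4 : -1 * s j x = -1 ↔ s j x = 1 := by
      constructor <;> intro h <;> linarith
    rw [excess_eq (hneg j x)]
    simp only [h3, h4]
  have h2 : (arcCount (signedBipartite s) A B : ℝ) - lam * arcCount (signedBipartite s) B A =
      ∑ j, (if Sum.inr j ∈ B then ∑ x with Sum.inl x ∈ A, excess lam (1 * s j x) else 0) +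
      ∑ j, (if Sum.inr j ∈ A then ∑ x with Sum.inl x ∈ B, excess lam (-1 * s j x) else 0) := by
    rw [arcCount_sub_eq_sum]
    simp only [Fintype.sum_sum_type, signedBipartite_adj_inl_inr, signedBipartite_adj_inr_inl,
      signedBipartite_adj_inl_inl, signedBipartite_adj_inr_inr, if_false, mul_zero, sub_zero, ite_self,
      Finset.sum_const_zero, zero_add, add_zero, e1, e2]
    rw [Finset.sum_comm]
    congr 1
    · refine Finset.sum_congr rfl fun j _ => ?_
      rw [Finset.sum_filter]
      by_cases hj : (Sum.inr j : H ⊕ J) ∈ B <;> simp [hj]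
    · refine Finset.sum_congr rfl fun j _ => ?_
      rw [Finset.sum_filter]
      by_cases hj : (Sum.inr j : H ⊕ J) ∈ A <;> simp [hj]
  rw [h2]
  have hmax : ∀ (p : Prop) [Decidable p] (t : ℝ), (if p then t else 0) ≤ max 0 t := by
    intro p _ t
    split_ifs
    · exact le_max_right _ _
    · exact le_max_left _ _
  exact add_le_add (Finset.sum_le_sum fun j _ => hmax _ _) (Finset.sum_le_sum fun j _ => hmax _ _)

/-- The digraph on `V` induced from `D` by a map `e : V → W`. -/
def pullback {V W : Type*} (e : V → W) (D : Digraph W) : Digraph V where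
  Adj u v := D.Adj (e u) (e v)

theorem arcCount_pullback {V W : Type*} (e : V ≃ W) (D : Digraph W) (A B : Finset V) :
    arcCount (pullback e D) A B = arcCount D (A.map e.toEmbedding) (B.map e.toEmbedding) := by
  classical
  unfold arcCount
  refine Finset.card_bij (fun p _ => (e p.1, e p.2)) ?_ ?_ ?_
  · intro p hp
    have hp := Finset.mem_filter.1 hp
    exact Finset.mem_filter.2 ⟨by simpa using hp.1, hp.2⟩
  · intro p _ p' _ h
    simpa [Prod.ext_iff] using h
  · rintro ⟨u, v⟩ h
    have h := Finset.mem_filter.1 h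
    refine ⟨(e.symm u, e.symm v), Finset.mem_filter.2 ⟨?_, ?_⟩, by simp⟩
    · simpa using h.1
    · simpa [pullback] using h.2

theorem arcCount_le {V : Type*} (D : Digraph V) (A B : Finset V) :
    arcCount D A B ≤ A.card * B.card := by
  classical
  exact (Finset.card_filter_le _ _).trans_eq (Finset.card_product A B)

theorem bias_le_of_forall_sub_le {V : Type*} [Fintype V] (D : Digraph V) {η lam X : ℝ}
    (hlam : 0 ≤ lam) (hη : lam * η < 1)
    (h : ∀ A B, (arcCount D A B : ℝ) - lam * arcCount D B A ≤ X) :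
    (bias D η : ℝ) ≤ X / (1 - lam * η) := by
  obtain ⟨A, B, hAB, hm⟩ := (isGreatest_bias D η).1
  rw [← hm, le_div_iff₀ (by linarith)]
  have h1 := h A B
  have h2 := mul_le_mul_of_nonneg_left hAB hlam
  linarith

/-- Reduction of indices modulo the number of types. It lets the number of leaves be arbitrary, so
that every `n` is reached. -/
theorem exists_balanced_map (τ : Type*) [Fintype τ] [Nonempty τ] [DecidableEq τ] (r : ℕ) :
    ∃ t : Fin r → τ, (Fintype.card τ ≤ r → Function.Surjective t) ∧
      ∀ y, (Finset.univ.filter fun j => t j = y).card ≤ r / Fintype.card τ + 1 := by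
  have hM : 0 < Fintype.card τ := Fintype.card_pos
  let e := Fintype.equivFin τ
  refine ⟨fun j => e.symm ⟨j % Fintype.card τ, Nat.mod_lt _ hM⟩, fun hr y => ?_, fun y => ?_⟩
  · refine ⟨⟨e y, (e y).2.trans_le hr⟩, ?_⟩
    rw [Equiv.symm_apply_eq]
    exact Fin.ext (Nat.mod_eq_of_lt (e y).2)
  · rw [← Finset.card_range (r / Fintype.card τ + 1)]
    refine Finset.card_le_card_of_injOn (fun j => (j : ℕ) / Fintype.card τ) (fun j _ => ?_)
      (fun j hj j' hj' h => ?_)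
    · simp only [Finset.coe_range, Set.mem_Iio]
      exact Nat.lt_succ_of_le (Nat.div_le_div_right j.2.le)
    · have hj := (Finset.mem_filter.1 hj).2
      have hj' := (Finset.mem_filter.1 hj').2
      have h2 := e.symm.injective (hj.trans hj'.symm)
      have h3 : (j : ℕ) % Fintype.card τ = j' % Fintype.card τ := congrArg Fin.val h2
      refine Fin.ext ?_
      rw [← Nat.div_add_mod (j : ℕ) (Fintype.card τ), ← Nat.div_add_mod (j' : ℕ) (Fintype.card τ),
        h3]
      simp only at h
      rw [h]

/-! ### The construction over a field of order `2 ^ k`. -/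

/-- The sign patterns of the leaves: at scale `i`, the leaf `(i, a, b, c, d)` sees those `x` for
which `a * x + b` lies in `W i`, with the sign `χ (c * x + d * x ^ 3)`. -/
noncomputable def leafSign {F : Type*} [Field F] [DecidableEq F] {k : ℕ} (χ : F → ℝ)
    (W : Fin k → Finset F) (τ : Fin k × Fˣ × F × F × F) (x : F) : ℝ :=
  if (τ.2.1 : F) * x + τ.2.2.1 ∈ W τ.1 then χ (τ.2.2.2.1 * x + τ.2.2.2.2 * x ^ 3) else 0

/-- The bound does not depend on `k`, although there are `k * (q - 1) * q ^ 3` leaf types; this is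
the saving of a factor `k`. -/
theorem sum_leafSign_excess_le {F : Type*} [Field F] [Fintype F] [DecidableEq F] [CharP F 2]
    {χ : F → ℝ} (hχ : ∀ u, χ u = 1 ∨ χ u = -1)
    (hadd : ∀ u v, χ (u + v) = χ u * χ v) (hne : ∃ u, χ u = -1) {lam : ℝ} (hlam : 1 < lam)
    {ε : ℝ} (hε : ε = 1 ∨ ε = -1) {k : ℕ} {W : Fin k → Finset F}
    (hW : ∀ i, (W i).card = 2 ^ (i : ℕ)) (S : Finset F) :
    ∑ τ, max 0 (∑ x ∈ S, excess lam (ε * leafSign χ W τ x)) ≤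
      36 * excessConst lam * (((Fintype.card F : ℝ) - 1) * (Fintype.card F : ℝ) ^ 3) := by
  have hq : (1 : ℝ) ≤ Fintype.card F := by exact_mod_cast Fintype.card_pos
  have hC : 0 ≤ excessConst lam := by
    have hc : 0 < lam - 1 := by linarith
    unfold excessConst
    positivity
  have hR : ∀ (i : Fin k) (a : Fˣ) (b c d : F),
      ∑ x ∈ S, excess lam (ε * leafSign χ W (i, a, b, c, d) x) =
      ∑ x ∈ affineTrace S (W i) a b, excess lam (ε * χ (c * x + d * x ^ 3)) := by
    intro i a b c d
    rw [affineTrace, Finset.sum_filter]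
    refine Finset.sum_congr rfl fun x _ => ?_
    simp only [leafSign]
    split_ifs
    · rfl
    · simp [excess]
  simp only [Fintype.sum_prod_type, hR]
  set q : ℝ := (Fintype.card F : ℝ) with hqdef
  calc _ ≤ ∑ i : Fin k, ∑ a : Fˣ, ∑ b, excessConst lam * q ^ 2 *
          min ((affineTrace S (W i) a b).card : ℝ) ((affineTrace S (W i) a b).card : ℝ)⁻¹ :=
        Finset.sum_le_sum fun i _ => Finset.sum_le_sum fun a _ => Finset.sum_le_sum fun b _ =>
          sum_excess_signs_le hχ hadd hne hlam hε _
    _ ≤ ∑ i : Fin k, excessConst lam * q ^ 2 * ((q - 1) * q *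
          min (2 ^ (i : ℕ) * (S.card / q)) (6 / (2 ^ (i : ℕ) * (S.card / q)))) := by
        refine Finset.sum_le_sum fun i _ => ?_
        simp only [← Finset.mul_sum]
        refine mul_le_mul_of_nonneg_left ?_ (by positivity)
        have h := sum_min_card_affineTrace_le S (W i)
          (Finset.card_pos.1 (by rw [hW]; positivity))
        have h' : (S.card : ℝ) * (W i).card / q = 2 ^ (i : ℕ) * (S.card / q) := by
          rw [hW]; push_cast; ring
        rwa [← hqdef, h'] at h
    _ = excessConst lam * q ^ 2 * ((q - 1) * q) * ∑ i ∈ Finset.range k,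
          min (2 ^ i * (S.card / q)) (6 / (2 ^ i * (S.card / q))) := by
        rw [Finset.sum_range, Finset.mul_sum]
        exact Finset.sum_congr rfl fun i _ => by ring
    _ ≤ excessConst lam * q ^ 2 * ((q - 1) * q) * 36 := by
        have : 0 ≤ q - 1 := by linarith
        exact mul_le_mul_of_nonneg_left (sum_scales_le k (by positivity)) (by positivity)
    _ = _ := by ring

theorem exists_digraph_of_field (F : Type*) [Field F] [Fintype F] [Algebra (ZMod 2) F]
    {k r n : ℕ} (hk : 0 < k) (hF : Fintype.card F = 2 ^ k) (hn : 2 ^ k + r = n)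
    (hr : k * ((2 ^ k - 1) * (2 ^ k) ^ 3) ≤ r) {lam η : ℝ} (hlam : 1 < lam) (hη : lam * η < 1) :
    ∃ D : Digraph (Fin n), IsOriented D ∧ NoIsolatedVertex D ∧
      (bias D η : ℝ) ≤ 144 * excessConst lam / (1 - lam * η) * (n / k) := by
  classical
  have hchar : CharP F 2 := charP_of_injective_algebraMap (algebraMap (ZMod 2) F).injective 2
  obtain ⟨χ, hχ, hadd, hne⟩ := exists_sign_character F
  have hWex : ∀ i : Fin k, ∃ W : Finset F, W.card = 2 ^ (i : ℕ) := fun i => by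
    obtain ⟨W, -, hW⟩ := Finset.exists_subset_card_eq (s := (Finset.univ : Finset F))
      (n := 2 ^ (i : ℕ)) (by
        rw [Finset.card_univ, hF]; exact Nat.pow_le_pow_right two_pos i.2.le)
    exact ⟨W, hW⟩
  choose W hW using hWex
  have hWne : ∀ i, (W i).Nonempty := fun i => Finset.card_pos.1 (by rw [hW]; positivity)
  have hM : Fintype.card (Fin k × Fˣ × F × F × F) = k * ((2 ^ k - 1) * (2 ^ k) ^ 3) := by
    simp only [Fintype.card_prod, Fintype.card_fin, Fintype.card_units, hF]; ring
  have : Nonempty (Fin k) := ⟨⟨0, hk⟩⟩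
  obtain ⟨t, ht, hfib⟩ := exists_balanced_map (Fin k × Fˣ × F × F × F) r
  replace ht := ht (hM ▸ hr)
  set s : Fin r → F → ℝ := fun j => leafSign χ W (t j) with hsdef
  have hs : ∀ j x, s j x = 0 ∨ s j x = 1 ∨ s j x = -1 := fun j x => by
    simp only [hsdef, leafSign]
    split_ifs
    · exact Or.inr (hχ _)
    · exact Or.inl rfl
  have hs0 : ∀ j x, ((t j).2.1 : F) * x + (t j).2.2.1 ∈ W (t j).1 → s j x = 1 ∨ s j x = -1 :=
    fun j x h => by
      simp only [hsdef, leafSign, if_pos h]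
      exact hχ _
  let e : Fin n ≃ F ⊕ Fin r := Fintype.equivOfCardEq (by simp [hF, hn])
  refine ⟨pullback e (signedBipartite s), ?_, ?_, ?_⟩
  · exact fun u v h h' => isOriented_signedBipartite s _ _ h h'
  · suffices h : ∀ u, ∃ v, (signedBipartite s).Adj u v ∨ (signedBipartite s).Adj v u by
      intro u
      obtain ⟨v, hv⟩ := h (e u)
      exact ⟨e.symm v, by simpa [pullback] using hv⟩
    rintro (x | j)
    -- A translation carries the hub `x` into the set of scale 0; surjectivity of `t` provides a
    -- leaf of that type.
    · obtain ⟨w, hw⟩ := hWne ⟨0, hk⟩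
      obtain ⟨j, hj⟩ := ht (⟨0, hk⟩, 1, w - x, 0, 0)
      exact ⟨.inr j, hs0 j x (by rw [hj]; simpa using hw)⟩
    · obtain ⟨w, hw⟩ := hWne (t j).1
      refine ⟨.inl (((t j).2.1⁻¹ : Fˣ) * (w - (t j).2.2.1)), (hs0 j _ ?_).symm⟩
      rw [Units.mul_inv_cancel_left, sub_add_cancel]
      exact hw
  · have hM0 : (0 : ℝ) < (k : ℝ) * (((2 : ℝ) ^ k - 1) * (2 ^ k) ^ 3) := by
      have h1 : (1 : ℝ) < 2 ^ k := one_lt_pow₀ one_lt_two hk.ne'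
      have h2 : (0 : ℝ) < 2 ^ k - 1 := by linarith
      have h3 : (0 : ℝ) < k := by exact_mod_cast hk
      positivity
    have hMr : (Fintype.card (Fin k × Fˣ × F × F × F) : ℝ) =
        (k : ℝ) * (((2 : ℝ) ^ k - 1) * (2 ^ k) ^ 3) := by
      rw [hM]; push_cast [Nat.one_le_two_pow]; ring
    have hC : 0 ≤ excessConst lam := by
      have hc : 0 < lam - 1 := by linarith
      unfold excessConst
      positivity
    have hk0 : (0 : ℝ) < k := by exact_mod_cast hk
    have hrM : (k : ℝ) * (((2 : ℝ) ^ k - 1) * (2 ^ k) ^ 3) ≤ r := by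
      rw [← hMr, hM]; exact_mod_cast hr
    have hside : ∀ ε : ℝ, ε = 1 ∨ ε = -1 → ∀ S : Finset F,
        ∑ j, max 0 (∑ x ∈ S, excess lam (ε * s j x)) ≤ 72 * excessConst lam * (n / k) := by
      intro ε hε S
      have hsum := sum_leafSign_excess_le hχ hadd hne hlam hε hW S
      rw [hF] at hsum
      push_cast at hsum
      set G : Fin k × Fˣ × F × F × F → ℝ :=
        fun τ => max 0 (∑ x ∈ S, excess lam (ε * leafSign χ W τ x)) with hG
      have hG0 : ∀ τ, 0 ≤ G τ := fun τ => le_max_left _ _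
      calc ∑ j, max 0 (∑ x ∈ S, excess lam (ε * s j x))
          = ∑ τ, ∑ j with t j = τ, G (t j) := (Finset.sum_fiberwise _ _ _).symm
        _ = ∑ τ, ((Finset.univ.filter fun j => t j = τ).card : ℝ) * G τ := by
            refine Finset.sum_congr rfl fun τ _ => ?_
            rw [← nsmul_eq_mul, ← Finset.sum_const]
            exact Finset.sum_congr rfl fun j hj => by rw [(Finset.mem_filter.1 hj).2]
        _ ≤ ∑ τ, (2 * (r : ℝ) / ((k : ℝ) * (((2 : ℝ) ^ k - 1) * (2 ^ k) ^ 3))) * G τ := by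
            refine Finset.sum_le_sum fun τ _ => mul_le_mul_of_nonneg_right ?_ (hG0 τ)
            have h1 : ((Finset.univ.filter fun j => t j = τ).card : ℝ) ≤
                ((r / Fintype.card (Fin k × Fˣ × F × F × F) : ℕ) : ℝ) + 1 := by
              exact_mod_cast hfib τ
            have h2 := Nat.cast_div_le (α := ℝ) (m := r)
              (n := Fintype.card (Fin k × Fˣ × F × F × F))
            rw [hMr] at h2
            -- Since every type occurs, the rounding `+ 1` costs only a factor 2.
            have h3 : 1 ≤ (r : ℝ) / ((k : ℝ) * (((2 : ℝ) ^ k - 1) * (2 ^ k) ^ 3)) := by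
              rwa [one_le_div hM0]
            rw [mul_div_assoc]
            linarith
        _ ≤ (2 * (r : ℝ) / ((k : ℝ) * (((2 : ℝ) ^ k - 1) * (2 ^ k) ^ 3))) *
              (36 * excessConst lam * (((2 : ℝ) ^ k - 1) * (2 ^ k) ^ 3)) := by
            rw [← Finset.mul_sum]
            exact mul_le_mul_of_nonneg_left hsum (by positivity)
        _ = 72 * excessConst lam * (r / k) := by
            have h1 : ((2 : ℝ) ^ k - 1) * (2 ^ k) ^ 3 ≠ 0 := right_ne_zero_of_mul hM0.ne'
            generalize ((2 : ℝ) ^ k - 1) * (2 ^ k) ^ 3 = m at h1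
            field_simp
            ring
        _ ≤ _ := by
            gcongr
            omega
    refine (bias_le_of_forall_sub_le _ (X := 144 * excessConst lam * (n / k)) (by linarith) hη
      fun A B => ?_).trans_eq (by ring)
    rw [arcCount_pullback, arcCount_pullback]
    exact ((arcCount_sub_le hs lam _ _).trans (add_le_add (hside 1 (Or.inl rfl) _)
      (hside (-1) (Or.inr rfl) _))).trans_eq (by ring)

/-! ### Choice of parameters for small and large `n`. -/

/-- An out-star with the trivial bound `n * n` suffices; `384 = 64 * 6` bounds `n * logb 2 n`. -/
theorem exists_digraph_of_small {n : ℕ} (hn : 2 ≤ n) (hn' : n < 64) (η : ℝ) :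
    ∃ D : Digraph (Fin n), IsOriented D ∧ NoIsolatedVertex D ∧
      (bias D η : ℝ) ≤ 384 * (n / Real.logb 2 n) := by
  let z : Fin n := ⟨0, by omega⟩
  refine ⟨⟨fun u v => u = z ∧ v ≠ z⟩, fun u v h h' => h'.2 h.1, fun u => ?_, ?_⟩
  · by_cases hu : u = z
    · exact ⟨⟨1, by omega⟩, Or.inl ⟨hu, fun h => by simp [z] at h⟩⟩
    · exact ⟨z, Or.inr ⟨rfl, hu⟩⟩
  · obtain ⟨A, B, -, hm⟩ := (isGreatest_bias (⟨fun u v => u = z ∧ v ≠ z⟩ : Digraph (Fin n)) η).1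
    have h1 : arcCount (⟨fun u v => u = z ∧ v ≠ z⟩ : Digraph (Fin n)) A B ≤ n * n :=
      (arcCount_le _ A B).trans (Nat.mul_le_mul (card_finset_fin_le A) (card_finset_fin_le B))
    rw [hm] at h1
    have hn0 : (2 : ℝ) ≤ n := by exact_mod_cast hn
    have h64 : (n : ℝ) ≤ 64 := by exact_mod_cast hn'.le
    have hlog : 0 < Real.logb 2 n := Real.logb_pos one_lt_two (by linarith)
    have hlog6 : Real.logb 2 n ≤ 6 := by
      rw [Real.logb_le_iff_le_rpow one_lt_two (by linarith)]
      norm_num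
      exact hn'.le
    have h2 : (bias (⟨fun u v => u = z ∧ v ≠ z⟩ : Digraph (Fin n)) η : ℝ) ≤ n * n := by
      exact_mod_cast h1
    refine h2.trans ?_
    rw [← mul_div_assoc, le_div_iff₀ hlog]
    have h3 : (n : ℝ) * Real.logb 2 n ≤ 384 := by nlinarith
    nlinarith

theorem exists_digraph_of_large {n : ℕ} (hn : 64 ≤ n) {lam η : ℝ} (hlam : 1 < lam)
    (hη : lam * η < 1) :
    ∃ D : Digraph (Fin n), IsOriented D ∧ NoIsolatedVertex D ∧
      (bias D η : ℝ) ≤ 144 * excessConst lam / (1 - lam * η) * 11 * (n / Real.logb 2 n) := by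
  obtain ⟨l, hl⟩ : ∃ l, l = Nat.log 2 n := ⟨_, rfl⟩
  have hl6 : 6 ≤ l := by
    rw [hl]; exact Nat.le_log_of_pow_le one_lt_two (by norm_num; exact hn)
  -- Chosen so that `2 * q ^ 5 ≤ n` for `q = 2 ^ k`: after removing the `q` hubs, at least `q ^ 5`
  -- leaves remain, enough for all types. The `11` absorbs the rounding, as `l + 1 ≤ 5 * k + 6`.
  obtain ⟨k, hk⟩ : ∃ k, k = (l - 1) / 5 := ⟨_, rfl⟩
  have hk0 : 0 < k := by omega
  have hkl : l + 1 ≤ 11 * k := by omega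
  have hpow : 2 * (2 ^ k) ^ 5 ≤ n := by
    calc 2 * (2 ^ k) ^ 5 = 2 ^ (5 * k + 1) := by rw [pow_succ 2 (5 * k), ← pow_mul, mul_comm k, mul_comm]
      _ ≤ 2 ^ l := Nat.pow_le_pow_right two_pos (by omega)
      _ ≤ n := by rw [hl]; exact Nat.pow_log_le_self 2 (by omega)
  have hkq : k ≤ 2 ^ k := Nat.lt_two_pow_self.le
  have hq1 : 1 ≤ 2 ^ k := Nat.one_le_two_pow
  have hM : k * ((2 ^ k - 1) * (2 ^ k) ^ 3) ≤ (2 ^ k) ^ 5 := by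
    calc k * ((2 ^ k - 1) * (2 ^ k) ^ 3) ≤ 2 ^ k * (2 ^ k * (2 ^ k) ^ 3) := by
          gcongr; omega
      _ = _ := by ring
  have hq5 : 2 ^ k ≤ (2 ^ k) ^ 5 := Nat.le_self_pow (by norm_num) _
  have : Fintype (GaloisField 2 k) := Fintype.ofFinite _
  have hF : Fintype.card (GaloisField 2 k) = 2 ^ k := by
    rw [← Nat.card_eq_fintype_card]; exact GaloisField.card 2 k hk0.ne'
  obtain ⟨D, h1, h2, h3⟩ := exists_digraph_of_field (GaloisField 2 k) (n := n)
    (r := n - 2 ^ k) hk0 hF (by omega) (by omega) hlam hη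
  refine ⟨D, h1, h2, h3.trans ?_⟩
  have hn0 : (64 : ℝ) ≤ n := by exact_mod_cast hn
  have hlog : 0 < Real.logb 2 n := Real.logb_pos one_lt_two (by linarith)
  have hlog' : Real.logb 2 n ≤ 11 * k := by
    have h4 : Real.logb 2 n ≤ (l + 1 : ℕ) := by
      rw [Real.logb_le_iff_le_rpow one_lt_two (by linarith), Real.rpow_natCast, hl]
      exact_mod_cast (Nat.lt_pow_succ_log_self one_lt_two n).le
    exact h4.trans (by exact_mod_cast hkl)
  have hC : 0 ≤ excessConst lam := by
    have hc : 0 < lam - 1 := by linarith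
    unfold excessConst
    positivity
  have hη' : 0 < 1 - lam * η := by linarith
  have hkr : (0 : ℝ) < k := by exact_mod_cast hk0
  rw [mul_assoc _ (11 : ℝ)]
  refine mul_le_mul_of_nonneg_left ?_ (by positivity)
  rw [← mul_div_assoc, div_le_div_iff₀ hkr hlog]
  nlinarith

end BiasConstruction

theorem mainTheorem8 (η : ℝ) (hη0 : 0 < η) (hη1 : η < 1) :
    ∃ K : ℝ, ∀ n : ℕ, 2 ≤ n →
      ∃ D : Digraph (Fin n),
        OrientedGraphBias.IsOriented D ∧
        OrientedGraphBias.NoIsolatedVertex D ∧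
        (OrientedGraphBias.bias D η : ℝ) ≤ K * ((n : ℝ) / Real.logb 2 (n : ℝ)) := by
  -- The choice `lam = 1 / √η` lies strictly between `1` and `1 / η`.
  have hs0 : 0 < √η := Real.sqrt_pos.2 hη0
  have hs1 : √η < 1 := by rw [Real.sqrt_lt' one_pos]; simpa using hη1
  have hlam : 1 < (√η)⁻¹ := (one_lt_inv₀ hs0).2 hs1
  have hη : (√η)⁻¹ * η < 1 := by
    rw [inv_mul_lt_iff₀ hs0, mul_one]
    nlinarith [Real.mul_self_sqrt hη0.le]
  refine ⟨max 384 (144 * BiasConstruction.excessConst (√η)⁻¹ / (1 - (√η)⁻¹ * η) * 11),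
    fun n hn => ?_⟩
  have hn0 : (2 : ℝ) ≤ n := by exact_mod_cast hn
  have hpos : 0 ≤ (n : ℝ) / Real.logb 2 n :=
    div_nonneg (by linarith) (Real.logb_nonneg one_lt_two (by linarith))
  rcases lt_or_ge n 64 with h | h
  · obtain ⟨D, h1, h2, h3⟩ := BiasConstruction.exists_digraph_of_small hn h η
    exact ⟨D, h1, h2, h3.trans (mul_le_mul_of_nonneg_right (le_max_left _ _) hpos)⟩
  · obtain ⟨D, h1, h2, h3⟩ := BiasConstruction.exists_digraph_of_large h hlam hη
    exact ⟨D, h1, h2, h3.trans (mul_le_mul_of_nonneg_right (le_max_right _ _) hpos)⟩
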